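/- Let $\mathbb D$ be the open unit disc and let $H^2$ be the Hardy space of holomorphic functions on $\mathbb D$ with square-summable Taylor coefficients (a Hilbert space with the $\ell^2$ norm of the coefficients); let $H^\infty$ be the space of bounded holomorphic functions on $\mathbb D$. For a holomorphic map $\varphi:\mathbb D\to\mathbb D$ let $C_\varphi f=f\circ\varphi$ on $H^2$, and call a closed subspace $\mathcal S\subseteq H^2$ invariant under $C_\varphi$ if $C_\varphi\mathcal S\subseteq\mathcal S$. A function $\theta\in H^\infty$ is inner if its nontangential boundary values have modulus $1$ almost everywhere on the unit circle; put $\mathcal Q_\theta=H^2\ominus\theta H^2$. Let $\theta$ be inner with $\theta(0)=0$, and write $\frac{\theta}{z}$ for the holomorphic function on $\mathbb D$ equal to $\theta(z)/z$ for $z\neq0$ and to $\theta'(0)$ at $0$. Let $a,b,c,d\in\mathbb C$ with $ad-bc=1$ be such that $\varphi(z)=\frac{az+b}{cz+d}$ is a holomorphic self-map of $\mathbb D$ (automatically nonconstant). Then $\sigma(z)=\frac{\bar a z-\bar c}{-\bar b z+\bar d}$ is a holomorphic self-map of $\mathbb D$, and with the meromorphic function $$\psi=\frac{\frac{\theta}{z}\circ\sigma}{\frac{\theta}{z}}$$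 on $\mathbb D$ (removable singularities being removed) the following are equivalent: 1. $\mathcal Q_\theta$ is a closed subspace invariant under $C_\varphi$; 2. $\psi\in H^2$; 3. $\psi\in H^\infty$; 4. $\frac{\theta}{z}H^2$ is a closed subspace invariant under $C_\sigma$. -/

import Mathlib

open Filter Topology
open scoped Complex.UnitDisc ComplexConjugate

namespace ModelSpace

noncomputable section

/-- Two power series that converge to the same function on the disc have the same coefficients. -/
theorem coeff_unique {f : 𝔻 → ℂ} {a b : ℕ → ℂ}
    (ha : ∀ z : 𝔻, HasSum (fun n => a n * (z : ℂ) ^ n) (f z))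
    (hb : ∀ z : 𝔻, HasSum (fun n => b n * (z : ℂ) ^ n) (f z)) : a = b := by
  have key : HasFPowerSeriesAt (fun _ : ℂ => (0 : ℂ))
      (FormalMultilinearSeries.ofScalars ℂ (fun n => a n - b n)) 0 := by
    rw [hasFPowerSeriesAt_iff]
    filter_upwards [Metric.ball_mem_nhds (0 : ℂ) one_pos] with z hz
    have hz' : ‖z‖ < 1 := by simpa using hz
    have h := (ha (Complex.UnitDisc.mk z hz')).sub (hb (Complex.UnitDisc.mk z hz'))
    simpa [FormalMultilinearSeries.coeff_ofScalars, sub_mul, mul_sub, mul_comm] using h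
  funext n
  have h : (FormalMultilinearSeries.ofScalars ℂ (fun n => a n - b n)).coeff n = 0 := by
    rw [HasFPowerSeriesAt.eq_zero key]
    rfl
  rw [FormalMultilinearSeries.coeff_ofScalars] at h
  exact sub_eq_zero.1 h

/-- The vector space of functions on the disc given by a power series with square-summable
coefficients. -/
def hardySubmodule : Submodule ℂ (𝔻 → ℂ) where
  carrier := {f | ∃ a : lp (fun _ : ℕ => ℂ) 2,
    ∀ z : 𝔻, HasSum (fun n => a n * (z : ℂ) ^ n) (f z)}
  zero_mem' := ⟨0, fun z => by simp [hasSum_zero]⟩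
  add_mem' := by
    rintro f g ⟨a, ha⟩ ⟨b, hb⟩
    exact ⟨a + b, fun z => by simpa [add_mul] using (ha z).add (hb z)⟩
  smul_mem' := by
    rintro c f ⟨a, ha⟩
    exact ⟨c • a, fun z => by simpa [mul_assoc] using (ha z).mul_left c⟩

/-- The Hardy space `H²` of the unit disc. It is a type of its own so that it does not inherit the
topology of pointwise convergence from `𝔻 → ℂ`; its norm is defined below. -/
def H2 : Type := hardySubmodule

namespace H2

instance : AddCommGroup H2 := inferInstanceAs (AddCommGroup hardySubmodule)

instance : Module ℂ H2 := inferInstanceAs (Module ℂ hardySubmodule)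

instance : CoeFun H2 (fun _ => 𝔻 → ℂ) := ⟨fun f => Subtype.val f⟩

/-- The linear map sending `f ∈ H²` to the sequence of its Taylor coefficients at `0`. -/
def coeff : H2 →ₗ[ℂ] lp (fun _ : ℕ => ℂ) 2 where
  toFun f := f.2.choose
  map_add' f g := by
    refine lp.ext (coeff_unique (f := fun z => f z + g z) (f + g).2.choose_spec fun z => ?_)
    simpa [add_mul] using (f.2.choose_spec z).add (g.2.choose_spec z)
  map_smul' c f := by
    refine lp.ext (coeff_unique (f := fun z => c * f z) (c • f).2.choose_spec fun z => ?_)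
    simpa [mul_assoc] using (f.2.choose_spec z).mul_left c

theorem hasSum_coeff (f : H2) (z : 𝔻) : HasSum (fun n => coeff f n * (z : ℂ) ^ n) (f z) :=
  f.2.choose_spec z

theorem coeff_injective : Function.Injective coeff := fun f g h =>
  Subtype.ext (funext fun z => (hasSum_coeff f z).unique (h ▸ hasSum_coeff g z))

/-- `‖f‖² = ∑ |aₙ|²`, where `aₙ` are the Taylor coefficients of `f`. -/
instance : NormedAddCommGroup H2 := NormedAddCommGroup.induced _ _ coeff coeff_injective

/-- `⟪f, g⟫ = ∑ conj aₙ * bₙ`, where `aₙ`, `bₙ` are the Taylor coefficients of `f`, `g`. -/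
instance : InnerProductSpace ℂ H2 := InnerProductSpace.induced coeff

end H2

/-- A function on the disc, extended by `0` to the complex plane. -/
def extendZero (f : 𝔻 → ℂ) (z : ℂ) : ℂ :=
  if h : ‖z‖ < 1 then f (Complex.UnitDisc.mk z h) else 0

/-- `f` is holomorphic on the disc. -/
def IsHolomorphic (f : 𝔻 → ℂ) : Prop :=
  DifferentiableOn ℂ (extendZero f) (Metric.ball 0 1)

/-- `f ∈ H²`. -/
def MemH2 (f : 𝔻 → ℂ) : Prop := f ∈ hardySubmodule

/-- `f ∈ H^∞`: `f` is a bounded holomorphic function on the disc. -/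
def MemHInf (f : 𝔻 → ℂ) : Prop :=
  IsHolomorphic f ∧ ∃ C : ℝ, ∀ z, ‖f z‖ ≤ C

/-- The function `f` has the nontangential limit `u` at the boundary point `ζ`: it tends to `u` as
`z → ζ` inside each nontangential approach region `|ζ - z| < M (1 - |z|)`. -/
def HasNontangentialLimit (f : 𝔻 → ℂ) (ζ u : ℂ) : Prop :=
  ∀ M : ℝ, Tendsto f
    (comap (fun z : 𝔻 => (z : ℂ)) (𝓝 ζ) ⊓ 𝓟 {z : 𝔻 | ‖ζ - z‖ < M * (1 - ‖(z : ℂ)‖)}) (𝓝 u)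

/-- `θ` is inner: it lies in `H^∞` and its nontangential boundary values have modulus `1` at almost
every point `exp (i t)` of the unit circle. -/
def IsInner (θ : 𝔻 → ℂ) : Prop :=
  MemHInf θ ∧
    ∀ᵐ t : ℝ, ∃ u : ℂ, ‖u‖ = 1 ∧ HasNontangentialLimit θ (Complex.exp (t * Complex.I)) u

/-- The subspace `θ H²` of `H²`, for a bounded holomorphic function `θ`. -/
def mulH2 (θ : 𝔻 → ℂ) : Submodule ℂ H2 where
  carrier := {f | ∃ g : H2, ∀ z, f z = θ z * g z}
  zero_mem' := ⟨0, fun z => (mul_zero (θ z)).symm⟩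
  add_mem' := by
    rintro f₁ f₂ ⟨g₁, h₁⟩ ⟨g₂, h₂⟩
    refine ⟨g₁ + g₂, fun z => ?_⟩
    change f₁ z + f₂ z = θ z * (g₁ z + g₂ z)
    rw [h₁, h₂, mul_add]
  smul_mem' := by
    rintro c f ⟨g, h⟩
    refine ⟨c • g, fun z => ?_⟩
    change c * f z = θ z * (c * g z)
    rw [h, mul_left_comm]

/-- The model space `H² ⊖ θ H²`. -/
def modelSpace (θ : 𝔻 → ℂ) : Submodule ℂ H2 := (mulH2 θ)ᗮ

/-- `S` belongs to the lattice of closed subspaces of `H²` that are invariant under the composition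
operator `f ↦ f ∘ φ`. -/
def MemLatComp (φ : 𝔻 → 𝔻) (S : Submodule ℂ H2) : Prop :=
  IsClosed (S : Set H2) ∧ ∀ f ∈ S, ∃ g ∈ S, ∀ z, g z = f (φ z)

/-- The self-map `φ` of the disc is given by the linear fractional formula
`φ z = (a z + b) / (c z + d)`, whose denominator has no zero in the disc. -/
def IsLinearFractional (φ : 𝔻 → 𝔻) (a b c d : ℂ) : Prop :=
  ∀ z : 𝔻, c * z + d ≠ 0 ∧ (φ z : ℂ) = (a * z + b) / (c * z + d)

/-- For a holomorphic function `θ` with `θ 0 = 0`, the holomorphic function `θ / z`, whose value at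
`0` is `θ' 0`. -/
def divZ (θ : 𝔻 → ℂ) (z : 𝔻) : ℂ := dslope (extendZero θ) 0 z

/-- The meromorphic quotient `F / G` of two holomorphic functions on the disc, `G` not identically
zero, is (after removal of its removable singularities) a function `h` with the property `P`. -/
def QuotientSatisfies (P : (𝔻 → ℂ) → Prop) (F G : 𝔻 → ℂ) : Prop :=
  ∃ h : 𝔻 → ℂ, P h ∧ ∀ z, G z ≠ 0 → h z = F z / G z

end

end ModelSpace

namespace ModelSpace

noncomputable section

/-! Write D(z) = -b̄z + d̄ and h = θ/z. Testing against reproducing kernels gives C_φ*(z f) = z D⁻²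
(f∘σ) (`adjoint_compOp_shift`), and both D and D⁻¹ are bounded on the disc. Since θH² is closed, Q_θ
is invariant under C_φ iff C_φ* maps θH² = z h H² into itself, and the formula reads C_φ*(θu) = z
D⁻² (h∘σ)(u∘σ). For u = 1, membership in θH² gives h∘σ ∈ D² h H², so ψ ∈ H². If ψ is bounded, the
right side is θ · D⁻² ψ (u∘σ), which lies in θH². The condition on hH² is read in the same way from
(hu)∘σ = h ψ (u∘σ).

The passage from H² to H^∞ uses that multiplication by h is isometric (`norm_mulOp_divZ`): ‖ψ k_w‖ =
‖(h∘σ) k_w‖ ≤ ‖k_w‖ for every kernel k_w, and evaluation at w yields |ψ(w)| ≤ 1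
(`norm_le_one_of_mul_kernel`).

The analytic inputs are the isometry of inner multipliers (`norm_inner_mul`) and the boundedness of
composition operators (`exists_comp`), both obtained from means over circles. -/

/-! ### Holomorphic functions on the disc and power series. -/

theorem extendZero_of_norm_lt (f : 𝔻 → ℂ) {z : ℂ} (hz : ‖z‖ < 1) :
    extendZero f z = f (Complex.UnitDisc.mk z hz) := dif_pos hz

theorem extendZero_coe (f : 𝔻 → ℂ) (z : 𝔻) : extendZero f (z : ℂ) = f z := by
  rw [extendZero_of_norm_lt f z.norm_lt_one, Complex.UnitDisc.mk_coe]

theorem isHolomorphic_iff {f : 𝔻 → ℂ} {F : ℂ → ℂ} (h : ∀ z : 𝔻, F z = f z) :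
    IsHolomorphic f ↔ DifferentiableOn ℂ F (Metric.ball 0 1) := by
  refine differentiableOn_congr fun z hz => ?_
  rw [extendZero_of_norm_lt f (by simpa using hz), ← h, Complex.UnitDisc.coe_mk]

theorem IsHolomorphic.mul {f g : 𝔻 → ℂ} (hf : IsHolomorphic f) (hg : IsHolomorphic g) :
    IsHolomorphic (fun z => f z * g z) :=
  (isHolomorphic_iff (F := extendZero f * extendZero g)
    (fun z => by simp [extendZero_coe])).2 (DifferentiableOn.mul hf hg)

theorem IsHolomorphic.comp {f : 𝔻 → ℂ} (hf : IsHolomorphic f) {φ : 𝔻 → 𝔻}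
    (hφ : IsHolomorphic (fun z => (φ z : ℂ))) : IsHolomorphic (f ∘ φ) :=
  (isHolomorphic_iff (F := extendZero f ∘ extendZero (fun z => (φ z : ℂ)))
    (fun z => by simp [extendZero_coe])).2 (DifferentiableOn.comp hf hφ fun z hz => by
      rw [extendZero_of_norm_lt _ (by simpa using hz)]
      simpa using (φ _).norm_lt_one)

/-- A holomorphic function on the disc is the sum of a power series. -/
theorem IsHolomorphic.exists_hasSum {f : 𝔻 → ℂ} (hf : IsHolomorphic f) :
    ∃ c : ℕ → ℂ, ∀ z : 𝔻, HasSum (fun n => c n * (z : ℂ) ^ n) (f z) := by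
  refine ⟨fun n => (n.factorial : ℂ)⁻¹ * iteratedDeriv n (extendZero f) 0, fun z => ?_⟩
  have h := Complex.hasSum_taylorSeries_on_ball hf (z := (z : ℂ)) (by simpa using z.norm_lt_one)
  rw [extendZero_coe] at h
  simpa [mul_assoc, mul_comm] using h

/-- A power series converging on the disc converges absolutely there. -/
theorem summable_norm_of_hasSum {f : 𝔻 → ℂ} {c : ℕ → ℂ}
    (hc : ∀ z : 𝔻, HasSum (fun n => c n * (z : ℂ) ^ n) (f z)) {r : ℝ} (hr₀ : 0 ≤ r) (hr : r < 1) :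
    Summable fun n => ‖c n‖ * r ^ n := by
  have h := (hc (Complex.UnitDisc.mk (r : ℂ) (by simpa [abs_of_nonneg hr₀] using hr))).summable.norm
  simpa [abs_of_nonneg hr₀] using h

theorem isHolomorphic_of_hasSum {f : 𝔻 → ℂ} {c : ℕ → ℂ}
    (hc : ∀ z : 𝔻, HasSum (fun n => c n * (z : ℂ) ^ n) (f z)) : IsHolomorphic f := by
  have key : HasFPowerSeriesOnBall (extendZero f) (FormalMultilinearSeries.ofScalars ℂ c) 0 1 := by
    refine ⟨ENNReal.le_of_forall_nnreal_lt fun r hr => ?_, one_pos, fun {y} hy => ?_⟩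
    · refine FormalMultilinearSeries.le_radius_of_summable _ ?_
      have hr1 : (r : ℝ) < 1 := by exact_mod_cast hr
      simpa [FormalMultilinearSeries.ofScalars_norm] using
        summable_norm_of_hasSum hc r.coe_nonneg hr1
    · have hy' : ‖y‖ < 1 := by
        simpa [Metric.eball, edist_zero_right, ← ofReal_norm, ENNReal.ofReal_lt_one] using hy
      rw [zero_add, extendZero_of_norm_lt f hy']
      simpa [FormalMultilinearSeries.ofScalars_apply_eq, mul_comm] using hc (Complex.UnitDisc.mk y hy')
  have h := key.differentiableOn
  refine h.mono fun z hz => ?_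
  simpa [Metric.eball, edist_zero_right, ← ofReal_norm, ENNReal.ofReal_lt_one] using hz

/-! ### Means over circles and Parseval's identity. -/

theorem norm_circleMap_lt_one {r : ℝ} (hr₀ : 0 ≤ r) (hr : r < 1) (t : ℝ) :
    ‖circleMap 0 r t‖ < 1 := by simpa [abs_of_nonneg hr₀] using hr

theorem IsHolomorphic.continuousOn_sphere {f : 𝔻 → ℂ} (hf : IsHolomorphic f) {r : ℝ} (hr₀ : 0 ≤ r)
    (hr : r < 1) : ContinuousOn (extendZero f) (Metric.sphere 0 |r|) :=
  hf.continuousOn.mono fun z hz => by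
    rw [abs_of_nonneg hr₀] at hz
    simp only [mem_sphere_iff_norm, sub_zero] at hz
    simpa [hz] using hr

theorem IsHolomorphic.circleIntegrable_norm_sq {f : 𝔻 → ℂ} (hf : IsHolomorphic f) {r : ℝ}
    (hr₀ : 0 ≤ r) (hr : r < 1) : CircleIntegrable (fun z => ‖extendZero f z‖ ^ 2) 0 r :=
  ((hf.continuousOn_sphere hr₀ hr).norm.pow 2).circleIntegrable'

/-- The mean of `|f|²` over the circle of radius `r`. -/
def meanSq (f : 𝔻 → ℂ) (r : ℝ) : ℝ := Real.circleAverage (fun z => ‖extendZero f z‖ ^ 2) 0 r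

/-- Parseval's identity on the circle of radius `r`. -/
theorem hasSum_meanSq {f : 𝔻 → ℂ} {c : ℕ → ℂ}
    (hc : ∀ z : 𝔻, HasSum (fun n => c n * (z : ℂ) ^ n) (f z)) {r : ℝ} (hr₀ : 0 ≤ r) (hr : r < 1) :
    HasSum (fun n => ‖c n‖ ^ 2 * r ^ (2 * n)) (meanSq f r) := by
  have hs := summable_norm_of_hasSum hc hr₀ hr
  have hsq : ∀ n, ‖c n‖ ^ 2 * r ^ (2 * n) = (‖c n‖ * r ^ n) ^ 2 := fun n => by ring
  have hsum : Summable fun n => ‖c n‖ ^ 2 * r ^ (2 * n) := by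
    simp_rw [hsq]
    refine Summable.of_norm_bounded_eventually (g := fun n => ‖c n‖ * r ^ n) hs ?_
    rw [Nat.cofinite_eq_atTop]
    filter_upwards [hs.tendsto_atTop_zero.eventually_le_const one_pos] with n hn
    have h0 : 0 ≤ ‖c n‖ * r ^ n := by positivity
    rw [Real.norm_of_nonneg (by positivity)]
    nlinarith
  refine hsum.hasSum_iff_tendsto_nat.2 ?_
  have hpoly : ∀ N : ℕ, ∑ n ∈ Finset.range N, ‖c n‖ ^ 2 * r ^ (2 * n) =
      Real.circleAverage (fun z => ‖∑ n ∈ Finset.range N, c n * z ^ n‖ ^ 2) 0 r := by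
    intro N
    -- The factors r ^ n rescale the circle of radius r to the unit circle.
    set p : Polynomial ℂ := ∑ n ∈ Finset.range N, Polynomial.monomial n (c n * (r : ℂ) ^ n) with hp
    have hcoeff : ∀ n, p.coeff n = if n < N then c n * (r : ℂ) ^ n else 0 := by
      intro n
      simp [hp, Polynomial.finsetSum_coeff, Polynomial.coeff_monomial]
    have h1 := p.sum_sq_norm_coeff_eq_circleAverage
    rw [Real.circleAverage_eq_circleAverage_zero_one]
    have h2 : ∀ z : ℂ, p.eval z = ∑ n ∈ Finset.range N, c n * ((r : ℂ) * z + 0) ^ n := by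
      intro z
      simp [hp, Polynomial.eval_finsetSum, Polynomial.eval_monomial, mul_pow, mul_assoc]
    simp_rw [← h2]
    rw [← h1]
    symm
    calc ∑ i ∈ p.support, ‖p.coeff i‖ ^ 2 = ∑ i ∈ Finset.range N, ‖p.coeff i‖ ^ 2 := by
          refine Finset.sum_subset (fun i hi => ?_) (fun i _ hi => by simpa using hi)
          rw [Polynomial.mem_support_iff, hcoeff] at hi
          by_contra h
          exact hi (if_neg (by simpa using h))
      _ = _ := by
          refine Finset.sum_congr rfl fun i hi => ?_
          rw [hcoeff, if_pos (Finset.mem_range.1 hi), hsq]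
          simp [abs_of_nonneg hr₀]
  simp_rw [hpoly]
  unfold meanSq Real.circleAverage
  refine Tendsto.const_smul ?_ _
  refine intervalIntegral.tendsto_integral_filter_of_dominated_convergence
    (fun _ => (∑' n, ‖c n‖ * r ^ n) ^ 2) (Eventually.of_forall fun N => ?_)
    (Eventually.of_forall fun N => Eventually.of_forall fun t _ => ?_) (by simp)
    (Eventually.of_forall fun t _ => ?_)
  · exact Continuous.aestronglyMeasurable (by fun_prop)
  · rw [Real.norm_of_nonneg (by positivity)]
    refine pow_le_pow_left₀ (norm_nonneg _) ?_ 2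
    refine (norm_sum_le _ _).trans ?_
    simp only [norm_mul, norm_pow, norm_circleMap_zero, abs_of_nonneg hr₀]
    exact hs.sum_le_tsum _ fun i _ => by positivity
  · beta_reduce
    rw [extendZero_of_norm_lt f (norm_circleMap_lt_one hr₀ hr t)]
    have h := (hc (Complex.UnitDisc.mk _ (norm_circleMap_lt_one hr₀ hr t))).tendsto_sum_nat
    exact (h.norm).pow 2

/-! ### The norm of H² through circle means. -/

theorem H2.isHolomorphic (f : H2) : IsHolomorphic f := isHolomorphic_of_hasSum (H2.hasSum_coeff f)

theorem H2.norm_eq (f : H2) : ‖f‖ = ‖H2.coeff f‖ := rfl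

theorem H2.ext {f g : H2} (h : ∀ z, f z = g z) : f = g := Subtype.ext (funext h)

theorem H2.coeff_eq {f : H2} {c : ℕ → ℂ}
    (hc : ∀ z : 𝔻, HasSum (fun n => c n * (z : ℂ) ^ n) (f z)) (n : ℕ) : H2.coeff f n = c n :=
  congrFun (coeff_unique (H2.hasSum_coeff f) hc) n

theorem H2.hasSum_norm_sq (f : H2) : HasSum (fun n => ‖H2.coeff f n‖ ^ 2) (‖f‖ ^ 2) := by
  have h := lp.hasSum_norm (p := 2) (by simp) (H2.coeff f)
  simpa [H2.norm_eq] using h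

/-- The norm in `H²` is the limit of the means over circles. -/
theorem H2.tendsto_meanSq (f : H2) : Tendsto (meanSq f) (𝓝[<] 1) (𝓝 (‖f‖ ^ 2)) := by
  have h := tendsto_tsum_of_dominated_convergence (𝓕 := 𝓝[<] (1 : ℝ))
    (f := fun r n => ‖H2.coeff f n‖ ^ 2 * r ^ (2 * n)) (g := fun n => ‖H2.coeff f n‖ ^ 2)
    (bound := fun n => ‖H2.coeff f n‖ ^ 2) (H2.hasSum_norm_sq f).summable (fun n => ?_) ?_
  · rw [(H2.hasSum_norm_sq f).tsum_eq] at h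
    refine h.congr' ?_
    filter_upwards [Ioo_mem_nhdsLT (zero_lt_one (α := ℝ))] with r hr
    exact (hasSum_meanSq (H2.hasSum_coeff f) hr.1.le hr.2).tsum_eq
  · have : Continuous fun r : ℝ => ‖H2.coeff f n‖ ^ 2 * r ^ (2 * n) := by fun_prop
    simpa [ContinuousWithinAt] using this.continuousWithinAt (s := Set.Iio 1) (x := 1)
  · filter_upwards [Ioo_mem_nhdsLT (zero_lt_one (α := ℝ))] with r hr n
    rw [Real.norm_of_nonneg (mul_nonneg (sq_nonneg _) (pow_nonneg hr.1.le _))]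
    exact mul_le_of_le_one_right (sq_nonneg _) (pow_le_one₀ hr.1.le hr.2.le)

theorem H2.meanSq_le (f : H2) {r : ℝ} (hr₀ : 0 ≤ r) (hr : r < 1) : meanSq f r ≤ ‖f‖ ^ 2 :=
  hasSum_le (fun _ => mul_le_of_le_one_right (sq_nonneg _) (pow_le_one₀ hr₀ hr.le))
    (hasSum_meanSq (H2.hasSum_coeff f) hr₀ hr) (H2.hasSum_norm_sq f)

/-- A holomorphic function with bounded means over circles lies in `H²`. -/
theorem exists_H2_of_meanSq_le {F : 𝔻 → ℂ} (hF : IsHolomorphic F) {K : ℝ} (hK : 0 ≤ K)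
    (h : ∀ r : ℝ, 0 ≤ r → r < 1 → meanSq F r ≤ K ^ 2) :
    ∃ f : H2, (∀ z, f z = F z) ∧ ‖f‖ ≤ K := by
  obtain ⟨c, hc⟩ := hF.exists_hasSum
  -- Parseval bounds each finite sum at radius r; then r → 1.
  have hfin : ∀ s : Finset ℕ, ∑ n ∈ s, ‖c n‖ ^ 2 ≤ K ^ 2 := by
    intro s
    have hcont : Continuous fun r : ℝ => ∑ n ∈ s, ‖c n‖ ^ 2 * r ^ (2 * n) := by fun_prop
    have ht := hcont.continuousWithinAt (s := Set.Iio 1) (x := 1)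
    simp only [ContinuousWithinAt, one_pow, mul_one] at ht
    refine le_of_tendsto ht ?_
    filter_upwards [Ioo_mem_nhdsLT (zero_lt_one (α := ℝ))] with r hr
    refine (sum_le_hasSum s (fun n _ => ?_) (hasSum_meanSq hc hr.1.le hr.2)).trans
      (h r hr.1.le hr.2)
    exact mul_nonneg (sq_nonneg _) (pow_nonneg hr.1.le _)
  have hsum : Summable fun n => ‖c n‖ ^ 2 := summable_of_sum_le (fun n => sq_nonneg _) hfin
  have hmem : Memℓp (E := fun _ : ℕ => ℂ) c 2 := memℓp_gen (by simpa using hsum)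
  let f : H2 := ⟨F, ⟨c, hmem⟩, hc⟩
  refine ⟨f, fun z => rfl, ?_⟩
  have h1 := H2.hasSum_norm_sq f
  simp_rw [H2.coeff_eq (f := f) hc] at h1
  exact (sq_le_sq₀ (norm_nonneg _) hK).1 (h1.tsum_eq ▸ hsum.tsum_le_of_sum_le hfin)

/-! ### Completeness and reproducing kernels. -/

namespace H2

@[simp] theorem add_apply (f g : H2) (z : 𝔻) : (f + g) z = f z + g z := rfl
@[simp] theorem sub_apply (f g : H2) (z : 𝔻) : (f - g) z = f z - g z := rfl
@[simp] theorem smul_apply (c : ℂ) (f : H2) (z : 𝔻) : (c • f) z = c * f z := rfl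
@[simp] theorem zero_apply (z : 𝔻) : (0 : H2) z = 0 := rfl

theorem coeff_surjective : Function.Surjective coeff := by
  intro a
  have hs : ∀ z : 𝔻, Summable fun n => a n * (z : ℂ) ^ n := fun z => by
    refine Summable.of_norm_bounded (g := fun n => ‖a‖ * ‖(z : ℂ)‖ ^ n)
      ((summable_geometric_of_lt_one (norm_nonneg _) z.norm_lt_one).mul_left _) fun n => ?_
    rw [norm_mul, norm_pow]
    exact mul_le_mul_of_nonneg_right (lp.norm_apply_le_norm (by simp) a n) (by positivity)
  let f : H2 := ⟨fun z => ∑' n, a n * (z : ℂ) ^ n, a, fun z => (hs z).hasSum⟩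
  exact ⟨f, lp.ext (coeff_unique (hasSum_coeff f) fun z => (hs z).hasSum)⟩

/-- The Taylor coefficients identify `H²` with the square-summable sequences. -/
def coeffEquiv : H2 ≃ₗᵢ[ℂ] lp (fun _ : ℕ => ℂ) 2 where
  toLinearEquiv := LinearEquiv.ofBijective coeff ⟨coeff_injective, coeff_surjective⟩
  norm_map' _ := rfl

/-- Needed for adjoints, double orthogonal complements and geometric series of operators. -/
instance : CompleteSpace H2 :=
  (completeSpace_congr (e := coeffEquiv.toEquiv) coeffEquiv.isometry.isUniformEmbedding).2
    inferInstance

theorem norm_conj_mul_lt_one (w z : 𝔻) : ‖conj (w : ℂ) * z‖ < 1 := by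
  rw [norm_mul, Complex.norm_conj]
  exact mul_lt_one_of_nonneg_of_lt_one_left (norm_nonneg _) w.norm_lt_one z.norm_lt_one.le

theorem exists_kernel (w : 𝔻) : ∃ k : H2, ∀ z : 𝔻, k z = (1 - conj (w : ℂ) * z)⁻¹ := by
  refine ⟨⟨fun z => (1 - conj (w : ℂ) * z)⁻¹, ⟨fun n => conj (w : ℂ) ^ n, ?_⟩, fun z => ?_⟩,
    fun _ => rfl⟩
  · refine memℓp_gen ?_
    refine (summable_geometric_of_lt_one (sq_nonneg _) w.sq_norm_lt_one).congr fun n => ?_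
    simp only [norm_pow, Complex.norm_conj, ENNReal.toReal_ofNat, Real.rpow_ofNat]
    exact pow_right_comm _ _ _
  · simpa [mul_pow] using hasSum_geometric_of_norm_lt_one (norm_conj_mul_lt_one w z)

/-- The reproducing kernel of `H²` at `w`. -/
def kernel (w : 𝔻) : H2 := (exists_kernel w).choose

theorem kernel_apply (w z : 𝔻) : kernel w z = (1 - conj (w : ℂ) * z)⁻¹ :=
  (exists_kernel w).choose_spec z

theorem one_sub_conj_mul_ne_zero (w z : 𝔻) : 1 - conj (w : ℂ) * z ≠ 0 := fun h => by
  have := norm_conj_mul_lt_one w z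
  rw [← sub_eq_zero.1 h, norm_one] at this
  exact lt_irrefl _ this

theorem coeff_kernel (w : 𝔻) (n : ℕ) : coeff (kernel w) n = conj (w : ℂ) ^ n := by
  refine coeff_eq (fun z => ?_) n
  rw [kernel_apply]
  simpa [mul_pow] using hasSum_geometric_of_norm_lt_one (norm_conj_mul_lt_one w z)

theorem inner_kernel (w : 𝔻) (f : H2) : inner ℂ (kernel w) f = f w := by
  have h := lp.hasSum_inner (𝕜 := ℂ) (coeff (kernel w)) (coeff f)
  refine h.unique ?_
  simpa [coeff_kernel, mul_comm] using hasSum_coeff f w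

theorem kernel_ne_zero (w : 𝔻) : kernel w ≠ 0 := fun h => by
  have := kernel_apply w w
  rw [h] at this
  exact inv_ne_zero (one_sub_conj_mul_ne_zero w w) this.symm

theorem norm_sq_kernel (w : 𝔻) : ‖kernel w‖ ^ 2 = (1 - ‖(w : ℂ)‖ ^ 2)⁻¹ := by
  have h := inner_self_eq_norm_sq_to_K (𝕜 := ℂ) (kernel w)
  rw [inner_kernel, kernel_apply, mul_comm, Complex.mul_conj, Complex.normSq_eq_norm_sq] at h
  have h' := congrArg Complex.re h.symm
  norm_cast at h'

theorem norm_apply_le (f : H2) (w : 𝔻) : ‖f w‖ ≤ ‖kernel w‖ * ‖f‖ := by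
  rw [← inner_kernel]
  exact norm_inner_le_norm _ _

end H2

/-! ### Bounded multipliers. -/

theorem MemHInf.comp {F : 𝔻 → ℂ} (hF : MemHInf F) {φ : 𝔻 → 𝔻}
    (hφ : IsHolomorphic (fun z => (φ z : ℂ))) : MemHInf (F ∘ φ) :=
  ⟨hF.1.comp hφ, hF.2.imp fun _ h z => h (φ z)⟩

/-- The pointwise bound |F f| ≤ C |f| passes to the mean over every circle, hence to the norm. -/
theorem exists_mul {F : 𝔻 → ℂ} (hF : IsHolomorphic F) {C : ℝ} (hC : ∀ z, ‖F z‖ ≤ C) (f : H2) :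
    ∃ g : H2, (∀ z, g z = F z * f z) ∧ ‖g‖ ≤ C * ‖f‖ := by
  have hC₀ : 0 ≤ C := (norm_nonneg _).trans (hC 0)
  refine exists_H2_of_meanSq_le (hF.mul f.isHolomorphic) (by positivity) fun r hr₀ hr => ?_
  calc meanSq (fun z => F z * f z) r
      ≤ Real.circleAverage (fun z => C ^ 2 • ‖extendZero f z‖ ^ 2) 0 r := by
        refine Real.circleAverage_mono ((hF.mul f.isHolomorphic).circleIntegrable_norm_sq hr₀ hr)
          ((f.isHolomorphic.circleIntegrable_norm_sq hr₀ hr).const_smul (a := C ^ 2)) fun z hz => ?_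
        have hz' : ‖z‖ < 1 := by
          rw [abs_of_nonneg hr₀, mem_sphere_iff_norm, sub_zero] at hz
          rwa [hz]
        rw [extendZero_of_norm_lt _ hz', extendZero_of_norm_lt _ hz', norm_mul, mul_pow,
          smul_eq_mul]
        exact mul_le_mul_of_nonneg_right (pow_le_pow_left₀ (norm_nonneg _) (hC _) 2) (sq_nonneg _)
    _ = C ^ 2 * meanSq f r := Real.circleAverage_fun_smul
    _ ≤ (C * ‖f‖) ^ 2 := by
        rw [mul_pow]
        exact mul_le_mul_of_nonneg_left (f.meanSq_le hr₀ hr) (sq_nonneg _)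

/-- Multiplication by a bounded holomorphic function. -/
def mulOp {F : 𝔻 → ℂ} (hF : MemHInf F) : H2 →L[ℂ] H2 :=
  LinearMap.mkContinuous
    { toFun f := (exists_mul hF.1 hF.2.choose_spec f).choose
      map_add' f g := H2.ext fun z => by
        rw [H2.add_apply, (exists_mul hF.1 hF.2.choose_spec (f + g)).choose_spec.1,
          (exists_mul hF.1 hF.2.choose_spec f).choose_spec.1,
          (exists_mul hF.1 hF.2.choose_spec g).choose_spec.1, H2.add_apply, mul_add]
      map_smul' c f := H2.ext fun z => by
        rw [RingHom.id_apply, H2.smul_apply, (exists_mul hF.1 hF.2.choose_spec (c • f)).choose_spec.1,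
          (exists_mul hF.1 hF.2.choose_spec f).choose_spec.1, H2.smul_apply, mul_left_comm] }
    hF.2.choose fun f => (exists_mul hF.1 hF.2.choose_spec f).choose_spec.2

@[simp] theorem mulOp_apply {F : 𝔻 → ℂ} (hF : MemHInf F) (f : H2) (z : 𝔻) :
    mulOp hF f z = F z * f z :=
  (exists_mul hF.1 hF.2.choose_spec f).choose_spec.1 z

/-- `mulOp` is built from an arbitrarily chosen bound of F; here any bound will do, in particular
the sharp one. -/
theorem norm_mulOp_le {F : 𝔻 → ℂ} (hF : MemHInf F) {C : ℝ} (hC : ∀ z, ‖F z‖ ≤ C) (f : H2) :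
    ‖mulOp hF f‖ ≤ C * ‖f‖ := by
  obtain ⟨g, hg, hle⟩ := exists_mul hF.1 hC f
  rwa [H2.ext fun z => (mulOp_apply hF f z).trans (hg z).symm]

/-- A multiplier that does not increase norms of kernels is bounded by `1`. -/
theorem norm_le_one_of_mul_kernel {F : 𝔻 → ℂ}
    (h : ∀ w, ∃ g : H2, (∀ z, g z = F z * H2.kernel w z) ∧ ‖g‖ ≤ ‖H2.kernel w‖) (w : 𝔻) :
    ‖F w‖ ≤ 1 := by
  obtain ⟨g, hg, hle⟩ := h w
  -- As k_w(w) = ‖k_w‖², the left side is |g(w)| ≤ ‖k_w‖ ‖g‖.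
  have h1 : ‖F w‖ * ‖H2.kernel w‖ ^ 2 ≤ ‖H2.kernel w‖ ^ 2 := by
    have h2 : ‖H2.kernel w w‖ = ‖H2.kernel w‖ ^ 2 := by
      rw [← H2.inner_kernel, inner_self_eq_norm_sq_to_K]
      simp
    rw [← h2, ← norm_mul, ← hg, h2, sq]
    exact (H2.norm_apply_le g w).trans (mul_le_mul_of_nonneg_left hle (norm_nonneg _))
  exact (mul_le_iff_le_one_left (by have := H2.kernel_ne_zero w; positivity)).1 h1

/-! ### Inner functions are isometric multipliers. -/

/-- Nontangential limits are radial limits. -/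
theorem HasNontangentialLimit.tendsto_radial {f : 𝔻 → ℂ} {t : ℝ} {u : ℂ}
    (h : HasNontangentialLimit f (Complex.exp (t * Complex.I)) u) :
    Tendsto (fun r : ℝ => extendZero f (circleMap 0 r t)) (𝓝[<] 1) (𝓝 u) := by
  have hball : ∀ᶠ r : ℝ in 𝓝[<] 1, 0 < r ∧ r < 1 :=
    Ioo_mem_nhdsLT (zero_lt_one (α := ℝ))
  classical
  let p : ℝ → 𝔻 := fun r =>
    if hr : ‖circleMap 0 r t‖ < 1 then Complex.UnitDisc.mk _ hr else 0
  have hp : ∀ r : ℝ, 0 < r ∧ r < 1 → (p r : ℂ) = circleMap 0 r t := fun r hr => by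
    simp only [p, dif_pos (norm_circleMap_lt_one hr.1.le hr.2 t), Complex.UnitDisc.coe_mk]
  -- On the radius |ζ - rζ| = 1 - r, so the aperture 2 is enough.
  have hlim : Tendsto p (𝓝[<] 1) (comap (fun z : 𝔻 => (z : ℂ)) (𝓝 (Complex.exp (t * Complex.I))) ⊓
      𝓟 {z : 𝔻 | ‖Complex.exp (t * Complex.I) - z‖ < 2 * (1 - ‖(z : ℂ)‖)}) := by
    refine tendsto_inf.2 ⟨tendsto_comap_iff.2 ?_, tendsto_principal.2 ?_⟩
    · have hc : Continuous fun r : ℝ => circleMap 0 r t := by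
        unfold circleMap
        fun_prop
      have h1 := hc.continuousWithinAt (s := Set.Iio 1) (x := 1)
      simp only [ContinuousWithinAt, circleMap, zero_add, Complex.ofReal_one, one_mul] at h1
      refine h1.congr' ?_
      filter_upwards [hball] with r hr
      simp [hp r hr, circleMap]
    · filter_upwards [hball] with r hr
      have h2 : Complex.exp (t * Complex.I) - circleMap 0 r t =
          ((1 - r : ℝ) : ℂ) * Complex.exp (t * Complex.I) := by
        simp [circleMap, sub_mul]
      rw [hp r hr, h2, norm_mul, Complex.norm_exp_ofReal_mul_I, Complex.norm_real,
        norm_circleMap_zero, abs_of_pos hr.1, Real.norm_of_nonneg (by linarith [hr.2])]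
      linarith [hr.2]
  refine ((h 2).comp hlim).congr' ?_
  filter_upwards [hball] with r hr
  rw [Function.comp_apply, ← extendZero_coe f, hp r hr]

/-- An inner function has unimodular radial limits, so multiplication by it preserves the norm of
bounded functions. -/
theorem norm_inner_mul_of_bounded {θ : 𝔻 → ℂ} (hθ : IsInner θ) (f : H2) {B : ℝ}
    (hB : ∀ z, ‖f z‖ ≤ B) : ‖mulOp hθ.1 f‖ = ‖f‖ := by
  obtain ⟨C, hC⟩ := hθ.1.2
  have hball : ∀ᶠ r : ℝ in 𝓝[<] 1, 0 < r ∧ r < 1 :=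
    Ioo_mem_nhdsLT (zero_lt_one (α := ℝ))
  -- Dominated convergence applies to |θf|² - |f|² = (|θ|² - 1)|f|². Boundedness of f supplies the
  -- dominating constant and makes boundary values of f unnecessary.
  have hdiff : Tendsto (fun r => meanSq (mulOp hθ.1 f) r - meanSq f r) (𝓝[<] 1) (𝓝 0) := by
    have hcongr : (fun r => Real.circleAverage
        (fun z => ‖extendZero (mulOp hθ.1 f) z‖ ^ 2 - ‖extendZero f z‖ ^ 2) 0 r) =ᶠ[𝓝[<] 1]
        fun r => meanSq (mulOp hθ.1 f) r - meanSq f r := by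
      filter_upwards [hball] with r hr
      exact Real.circleAverage_fun_sub ((H2.isHolomorphic _).circleIntegrable_norm_sq hr.1.le hr.2)
        ((H2.isHolomorphic _).circleIntegrable_norm_sq hr.1.le hr.2)
    refine Tendsto.congr' hcongr ?_
    have h0 : (0 : ℝ) = (2 * Real.pi)⁻¹ • ∫ _ in (0 : ℝ)..(2 * Real.pi), (0 : ℝ) := by simp
    rw [h0]
    unfold Real.circleAverage
    refine Tendsto.const_smul ?_ _
    refine intervalIntegral.tendsto_integral_filter_of_dominated_convergence
      (fun _ => (C * B) ^ 2 + B ^ 2) ?_ ?_ (by simp) ?_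
    · filter_upwards [hball] with r hr
      have hI : CircleIntegrable
          (fun z => ‖extendZero (mulOp hθ.1 f) z‖ ^ 2 - ‖extendZero f z‖ ^ 2) 0 r :=
        ((H2.isHolomorphic _).circleIntegrable_norm_sq hr.1.le hr.2).sub
          ((H2.isHolomorphic _).circleIntegrable_norm_sq hr.1.le hr.2)
      exact IntervalIntegrable.aestronglyMeasurable_restrict_uIoc hI
    · filter_upwards [hball] with r hr
      refine Eventually.of_forall fun t _ => ?_
      rw [extendZero_of_norm_lt _ (norm_circleMap_lt_one hr.1.le hr.2 t),
        extendZero_of_norm_lt _ (norm_circleMap_lt_one hr.1.le hr.2 t), mulOp_apply]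
      refine (norm_sub_le _ _).trans (add_le_add ?_ ?_)
      · rw [norm_pow, norm_norm, norm_mul]
        exact pow_le_pow_left₀ (by positivity) (mul_le_mul (hC _) (hB _) (norm_nonneg _)
          ((norm_nonneg _).trans (hC 0))) 2
      · rw [norm_pow, norm_norm]
        exact pow_le_pow_left₀ (by positivity) (hB _) 2
    · filter_upwards [hθ.2] with t ht _
      obtain ⟨u, hu, hlim⟩ := ht
      have h1 : Tendsto (fun r : ℝ => ‖extendZero θ (circleMap 0 r t)‖ ^ 2 - 1) (𝓝[<] 1) (𝓝 0) := by
        have := ((hlim.tendsto_radial.norm).pow 2).sub_const 1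
        simpa [hu] using this
      refine squeeze_zero_norm' (a := fun r : ℝ =>
        |‖extendZero θ (circleMap 0 r t)‖ ^ 2 - 1| * B ^ 2) ?_ (by simpa using h1.abs.mul_const _)
      filter_upwards [hball] with r hr
      rw [extendZero_of_norm_lt _ (norm_circleMap_lt_one hr.1.le hr.2 t),
        extendZero_of_norm_lt _ (norm_circleMap_lt_one hr.1.le hr.2 t),
        extendZero_of_norm_lt _ (norm_circleMap_lt_one hr.1.le hr.2 t), mulOp_apply, norm_mul,
        mul_pow, ← sub_one_mul, norm_mul, norm_pow, norm_norm, Real.norm_eq_abs]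
      exact mul_le_mul_of_nonneg_left (pow_le_pow_left₀ (norm_nonneg _) (hB _) 2) (abs_nonneg _)
  have hlim := ((mulOp hθ.1 f).tendsto_meanSq).sub f.tendsto_meanSq
  have h := tendsto_nhds_unique hdiff hlim
  rw [eq_comm, sub_eq_zero] at h
  exact (sq_eq_sq₀ (norm_nonneg _) (norm_nonneg _)).1 h

/-- Functions in `H²` are limits of bounded ones. -/
theorem H2.mem_closure_bounded (f : H2) : f ∈ closure {g : H2 | ∃ B : ℝ, ∀ z, ‖g z‖ ≤ B} := by
  have h := (lp.hasSum_single (p := 2) (by simp) (H2.coeff f)).map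
    (H2.coeffEquiv.symm : lp (fun _ : ℕ => ℂ) 2 →+ H2) H2.coeffEquiv.symm.continuous
  have hf : H2.coeffEquiv.symm (H2.coeff f) = f := H2.coeffEquiv.symm_apply_apply f
  -- Each term is a monomial aₙ zⁿ, bounded by |aₙ|.
  have key : ∀ n, ∃ B : ℝ, ∀ z, ‖H2.coeffEquiv.symm (lp.single 2 n (H2.coeff f n)) z‖ ≤ B := by
    intro n
    refine ⟨‖H2.coeff f n‖, fun z => ?_⟩
    have h1 := H2.hasSum_coeff (H2.coeffEquiv.symm (lp.single 2 n (H2.coeff f n))) z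
    have h2 : H2.coeff (H2.coeffEquiv.symm (lp.single 2 n (H2.coeff f n))) =
      lp.single 2 n (H2.coeff f n) := H2.coeffEquiv.apply_symm_apply _
    rw [h2] at h1
    rw [h1.unique (hasSum_single n fun m hm => by simp [hm])]
    simpa using mul_le_of_le_one_right (norm_nonneg _)
      (pow_le_one₀ (n := n) (norm_nonneg (z : ℂ)) z.norm_lt_one.le)
  refine mem_closure_of_tendsto (b := atTop) (f := fun s : Finset ℕ =>
    ∑ n ∈ s, H2.coeffEquiv.symm (lp.single 2 n (H2.coeff f n))) ?_ (Eventually.of_forall fun s => ?_)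
  · have h3 : HasSum (fun n => H2.coeffEquiv.symm (lp.single 2 n (H2.coeff f n)))
      (H2.coeffEquiv.symm (H2.coeff f)) := h
    rwa [hf] at h3
  · induction s using Finset.induction_on with
    | empty => exact ⟨0, fun z => by simp⟩
    | insert n s hn ih =>
      obtain ⟨B, hB⟩ := ih
      obtain ⟨D, hD⟩ := key n
      refine ⟨D + B, fun z => ?_⟩
      rw [Finset.sum_insert hn]
      exact (norm_add_le _ _).trans (add_le_add (hD z) (hB z))

/-- Multiplication by an inner function is an isometry of `H²`. -/
theorem norm_inner_mul {θ : 𝔻 → ℂ} (hθ : IsInner θ) (f : H2) : ‖mulOp hθ.1 f‖ = ‖f‖ := by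
  have hcl : IsClosed {f : H2 | ‖mulOp hθ.1 f‖ = ‖f‖} :=
    isClosed_eq (by fun_prop) (by fun_prop)
  refine closure_minimal (fun g hg => ?_) hcl f.mem_closure_bounded
  obtain ⟨B, hB⟩ := hg
  exact norm_inner_mul_of_bounded hθ g hB

theorem isInner_coe : IsInner (fun z : 𝔻 => (z : ℂ)) := by
  refine ⟨⟨(isHolomorphic_iff (F := id) fun _ => rfl).2 differentiableOn_id, 1,
    fun z => z.norm_lt_one.le⟩, Eventually.of_forall fun t => ⟨_, Complex.norm_exp_ofReal_mul_I t,
    fun M => tendsto_inf_left tendsto_comap⟩⟩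

/-- Multiplication by the independent variable. -/
def shift : H2 →ₗᵢ[ℂ] H2 where
  toLinearMap := mulOp isInner_coe.1
  norm_map' := norm_inner_mul isInner_coe

@[simp] theorem shift_apply (f : H2) (z : 𝔻) : shift f z = z * f z := mulOp_apply isInner_coe.1 f z

/-! ### Littlewood's subordination principle and composition operators. -/

/-- For `f ∈ H²` there is a holomorphic function `A` on the disc such that `2 Re A - ‖f‖²`, the
Poisson integral of the boundary values of `|f|²`, is a majorant of `|f|²`. -/
theorem H2.exists_harmonic_majorant (f : H2) : ∃ A : 𝔻 → ℂ, IsHolomorphic A ∧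
    (∀ w, ‖f w‖ ^ 2 ≤ 2 * (A w).re - ‖f‖ ^ 2) ∧ ∀ w, ‖A w‖ ≤ (1 - ‖(w : ℂ)‖)⁻¹ * ‖f‖ ^ 2 := by
  have hex : ∀ w : 𝔻, ∃ v : H2, v - conj (w : ℂ) • shift v = f ∧
      HasSum (fun n => inner ℂ ((shift.toContinuousLinearMap ^ n) f) f * (w : ℂ) ^ n)
        (inner ℂ v f) := by
    intro w
    -- With S the shift and T = w̄S, take v = (1 - T)⁻¹ f = ∑ w̄ⁿ Sⁿ f and A(w) = ⟪v, f⟫.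
    -- Conjugate-linearity in the first slot makes A a power series in w.
    let T : H2 →L[ℂ] H2 := conj (w : ℂ) • shift.toContinuousLinearMap
    have hT : ‖T‖ < 1 := by
      rw [norm_smul, Complex.norm_conj]
      exact (mul_le_of_le_one_right (norm_nonneg _) shift.norm_toContinuousLinearMap_le).trans_lt
        w.norm_lt_one
    have hs := summable_geometric_of_norm_lt_one hT
    refine ⟨(∑' n, T ^ n) f, ?_, ?_⟩
    · have h1 := congrArg (fun L : H2 →L[ℂ] H2 => L f) (mul_neg_geom_series T hT)
      simpa [T] using h1
    · have h2 := hs.hasSum.mapL ((ContinuousLinearMap.apply ℂ H2 f))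
      have h3 := ((innerSL ℂ f).hasSum h2).star
      simp only [ContinuousLinearMap.apply_apply, innerSL_apply_apply, RCLike.star_def,
        inner_conj_symm] at h3
      have h4 : ∀ n, inner ℂ ((shift.toContinuousLinearMap ^ n) f) f * (w : ℂ) ^ n =
          inner ℂ ((T ^ n) f) f := fun n => by
        simp [T, smul_pow, mul_comm]
      simp_rw [h4]
      exact h3
  choose v hv hA using hex
  refine ⟨fun w => inner ℂ (v w) f, isHolomorphic_of_hasSum hA, fun w => ?_, fun w => ?_⟩
  -- Expanding f = v - w̄Sv with S isometric gives 2 Re A(w) - ‖f‖² = (1 - |w|²) ‖v‖². Also f(w) =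
  -- (1 - |w|²) v(w), and the kernel bound for |v(w)| concludes.
  · have hr : ‖f‖ ^ 2 = ‖v w‖ ^ 2 - 2 * (inner ℂ (v w) (conj (w : ℂ) • shift (v w))).re +
        ‖(w : ℂ)‖ ^ 2 * ‖v w‖ ^ 2 := by
      have h1 := norm_sub_sq (𝕜 := ℂ) (v w) (conj (w : ℂ) • shift (v w))
      rw [hv, norm_smul, shift.norm_map, Complex.norm_conj, mul_pow] at h1
      exact h1
    have hi : (inner ℂ (v w) f).re =
        ‖v w‖ ^ 2 - (inner ℂ (v w) (conj (w : ℂ) • shift (v w))).re := by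
      conv_lhs => rw [← hv w]
      rw [inner_sub_right, Complex.sub_re, inner_self_eq_norm_sq_to_K]
      norm_cast
    have hval : f w = (1 - ‖(w : ℂ)‖ ^ 2 : ℝ) * v w w := by
      conv_lhs => rw [← hv w]
      rw [H2.sub_apply, H2.smul_apply, shift_apply, ← mul_assoc, mul_comm (conj _),
        Complex.mul_conj, Complex.normSq_eq_norm_sq]
      push_cast
      ring
    have hpos : 0 < 1 - ‖(w : ℂ)‖ ^ 2 := sub_pos.2 w.sq_norm_lt_one
    have hle : ‖v w w‖ ^ 2 ≤ (1 - ‖(w : ℂ)‖ ^ 2)⁻¹ * ‖v w‖ ^ 2 := by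
      rw [← H2.norm_sq_kernel, ← mul_pow]
      exact pow_le_pow_left₀ (norm_nonneg _) ((v w).norm_apply_le w) 2
    have h4 : ‖f w‖ ^ 2 ≤ (1 - ‖(w : ℂ)‖ ^ 2) * ‖v w‖ ^ 2 := by
      rw [hval, norm_mul, Complex.norm_real, Real.norm_of_nonneg hpos.le, mul_pow]
      calc _ ≤ (1 - ‖(w : ℂ)‖ ^ 2) ^ 2 * ((1 - ‖(w : ℂ)‖ ^ 2)⁻¹ * ‖v w‖ ^ 2) := by gcongr
        _ = _ := by field_simp
    rw [hi]
    linarith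
  · have h1 : ‖v w‖ ≤ (1 - ‖(w : ℂ)‖)⁻¹ * ‖f‖ := by
      rw [inv_mul_eq_div, le_div_iff₀ (sub_pos.2 w.norm_lt_one)]
      have h2 := norm_sub_norm_le (v w) (conj (w : ℂ) • shift (v w))
      rw [hv, norm_smul, shift.norm_map, Complex.norm_conj] at h2
      linarith
    calc ‖inner ℂ (v w) f‖ ≤ ‖v w‖ * ‖f‖ := norm_inner_le_norm _ _
      _ ≤ (1 - ‖(w : ℂ)‖)⁻¹ * ‖f‖ * ‖f‖ := by gcongr
      _ = _ := by ring

/-- Littlewood's subordination principle. -/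
theorem exists_comp {φ : 𝔻 → 𝔻} (hφ : IsHolomorphic (fun z => (φ z : ℂ))) (f : H2) :
    ∃ g : H2, (∀ z, g z = f (φ z)) ∧
      ‖g‖ ≤ √(2 * (1 - ‖(φ 0 : ℂ)‖)⁻¹) * ‖f‖ := by
  obtain ⟨A, hA, hfA, hbd⟩ := f.exists_harmonic_majorant
  have hpos : 0 < 1 - ‖(φ 0 : ℂ)‖ := sub_pos.2 (φ 0).norm_lt_one
  refine exists_H2_of_meanSq_le (f.isHolomorphic.comp hφ) (by positivity) fun r hr₀ hr => ?_
  have hAφ := hA.comp hφ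
  have hcI : CircleIntegrable (extendZero (A ∘ φ)) 0 r :=
    (hAφ.continuousOn_sphere hr₀ hr).circleIntegrable'
  have hsub : Metric.closedBall (0 : ℂ) |r| ⊆ Metric.ball 0 1 :=
    Metric.closedBall_subset_ball (by rwa [abs_of_nonneg hr₀])
  -- The mean value property of A∘φ makes the mean of the majorant independent of r.
  have hmean : Real.circleAverage (extendZero (A ∘ φ)) 0 r = A (φ 0) := by
    rw [DiffContOnCl.circleAverage ((DifferentiableOn.mono hAφ
      hsub).diffContOnCl_ball subset_rfl)]
    simpa using extendZero_coe (A ∘ φ) 0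
  have hmean' : Real.circleAverage (fun z => Complex.reCLM (extendZero (A ∘ φ) z)) 0 r =
      (A (φ 0)).re := by
    rw [← Complex.reCLM_apply, ← hmean]
    exact ContinuousLinearMap.circleAverage_comp_comm Complex.reCLM hcI
  have hreI : CircleIntegrable (fun z => Complex.reCLM (extendZero (A ∘ φ) z)) 0 r :=
    (Complex.reCLM.continuous.comp_continuousOn
      (hAφ.continuousOn_sphere hr₀ hr)).circleIntegrable'
  calc meanSq (f ∘ φ) r
      ≤ Real.circleAverage (fun z => (2 : ℝ) • Complex.reCLM (extendZero (A ∘ φ) z)) 0 r := by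
        refine Real.circleAverage_mono
          ((f.isHolomorphic.comp hφ).circleIntegrable_norm_sq hr₀ hr)
          (hreI.const_smul (a := (2 : ℝ))) fun z hz => ?_
        have hz' : ‖z‖ < 1 := by simpa using hsub (Metric.sphere_subset_closedBall hz)
        rw [extendZero_of_norm_lt _ hz', extendZero_of_norm_lt _ hz']
        have := hfA (φ (Complex.UnitDisc.mk z hz'))
        simp only [Function.comp_apply, Complex.reCLM_apply, smul_eq_mul]
        nlinarith [sq_nonneg ‖f‖]
    _ = 2 * (A (φ 0)).re := by rw [Real.circleAverage_fun_smul, hmean', smul_eq_mul]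
    _ ≤ 2 * ((1 - ‖(φ 0 : ℂ)‖)⁻¹ * ‖f‖ ^ 2) := by
        gcongr
        exact (Complex.re_le_norm _).trans (hbd _)
    _ = (√(2 * (1 - ‖(φ 0 : ℂ)‖)⁻¹) * ‖f‖) ^ 2 := by
        rw [mul_pow, Real.sq_sqrt (by positivity)]
        ring

/-- The composition operator with symbol `φ` on `H²`. -/
def compOp {φ : 𝔻 → 𝔻} (hφ : IsHolomorphic (fun z => (φ z : ℂ))) : H2 →L[ℂ] H2 :=
  LinearMap.mkContinuous
    { toFun f := (exists_comp hφ f).choose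
      map_add' f g := H2.ext fun z => by
        rw [H2.add_apply, (exists_comp hφ (f + g)).choose_spec.1, (exists_comp hφ f).choose_spec.1,
          (exists_comp hφ g).choose_spec.1, H2.add_apply]
      map_smul' c f := H2.ext fun z => by
        rw [RingHom.id_apply, H2.smul_apply, (exists_comp hφ (c • f)).choose_spec.1,
          (exists_comp hφ f).choose_spec.1, H2.smul_apply] }
    _ fun f => (exists_comp hφ f).choose_spec.2

@[simp] theorem compOp_apply {φ : 𝔻 → 𝔻} (hφ : IsHolomorphic (fun z => (φ z : ℂ))) (f : H2) (z : 𝔻) :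
    compOp hφ f z = f (φ z) :=
  (exists_comp hφ f).choose_spec.1 z

/-! ### Linear fractional maps and the adjoint formula. -/

section LinearFractional

variable {φ : 𝔻 → 𝔻} {a b c d : ℂ}

theorem IsLinearFractional.isHolomorphic (hφ : IsLinearFractional φ a b c d) :
    IsHolomorphic (fun z => (φ z : ℂ)) := by
  refine (isHolomorphic_iff (F := fun z => (a * z + b) / (c * z + d)) fun z => (hφ z).2.symm).2 ?_
  refine DifferentiableOn.div (by fun_prop) (by fun_prop) fun z hz => ?_
  exact (hφ (Complex.UnitDisc.mk z (by simpa using hz))).1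

theorem IsLinearFractional.norm_lt (hφ : IsLinearFractional φ a b c d) (z : 𝔻) :
    ‖a * z + b‖ < ‖c * z + d‖ := by
  have h := (φ z).norm_lt_one
  rwa [(hφ z).2, norm_div, div_lt_one (norm_pos_iff.2 (hφ z).1)] at h

theorem IsLinearFractional.norm_b_lt_norm_d (hφ : IsLinearFractional φ a b c d) : ‖b‖ < ‖d‖ := by
  simpa using hφ.norm_lt 0

/-- The closed disc is needed for the reflected point in `transpose_norm_lt`, which may lie on the
circle. -/
theorem IsLinearFractional.norm_le (hφ : IsLinearFractional φ a b c d) {w : ℂ} (hw : ‖w‖ ≤ 1) :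
    ‖a * w + b‖ ≤ ‖c * w + d‖ := by
  have hcl : IsClosed {w : ℂ | ‖a * w + b‖ ≤ ‖c * w + d‖} :=
    isClosed_le (by fun_prop) (by fun_prop)
  have hmem : w ∈ closure (Metric.ball (0 : ℂ) 1) := by
    rw [closure_ball _ one_ne_zero]
    simpa using hw
  refine closure_minimal (fun z hz => ?_) hcl hmem
  exact (hφ.norm_lt (Complex.UnitDisc.mk z (by simpa using hz))).le

/-- As ‖b‖ < ‖d‖, this bounds D away from 0 uniformly, so D⁻¹ is a bounded multiplier. -/
theorem norm_sub_norm_le_transpose_denom (b d : ℂ) (z : 𝔻) :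
    ‖d‖ - ‖b‖ ≤ ‖-conj b * z + conj d‖ := by
  have h : ‖conj b * (z : ℂ)‖ ≤ ‖b‖ := by
    rw [norm_mul, Complex.norm_conj]
    exact mul_le_of_le_one_right (norm_nonneg _) z.norm_lt_one.le
  calc ‖d‖ - ‖b‖ ≤ ‖conj d‖ - ‖conj b * (z : ℂ)‖ := by
        rw [Complex.norm_conj]
        exact sub_le_sub_left h _
    _ ≤ ‖conj d - conj b * z‖ := norm_sub_norm_le _ _
    _ = _ := by ring_nf

theorem IsLinearFractional.transpose_denom_ne_zero (hφ : IsLinearFractional φ a b c d) (z : 𝔻) :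
    -conj b * z + conj d ≠ 0 :=
  norm_pos_iff.1 ((sub_pos.2 hφ.norm_b_lt_norm_d).trans_le (norm_sub_norm_le_transpose_denom b d z))

/-- If |σ(z)| ≥ 1, the point w with w̄ = 1/σ(z) lies in the closed disc and z · conj(aw + b) =
conj(cw + d). Since |z| < 1, this contradicts |aw + b| ≤ |cw + d| unless both vanish, which the
determinant forbids. -/
theorem IsLinearFractional.transpose_norm_lt (hφ : IsLinearFractional φ a b c d)
    (hdet : a * d - b * c = 1) (z : 𝔻) :
    ‖conj a * z + -conj c‖ < ‖-conj b * z + conj d‖ := by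
  by_contra! h
  have hden := hφ.transpose_denom_ne_zero z
  have hnum : conj a * z + -conj c ≠ 0 := norm_pos_iff.1 ((norm_pos_iff.2 hden).trans_le h)
  obtain ⟨w, hw⟩ : ∃ w : ℂ, conj w = (-conj b * z + conj d) / (conj a * z + -conj c) :=
    ⟨conj _, Complex.conj_conj _⟩
  have hw1 : ‖w‖ ≤ 1 := by
    rw [← Complex.norm_conj, hw, norm_div]
    exact div_le_one_of_le₀ h (norm_nonneg _)
  have heq : (z : ℂ) * (conj a * conj w + conj b) = conj c * conj w + conj d := by
    rw [eq_div_iff hnum] at hw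
    linear_combination hw
  have heq' : ‖(z : ℂ)‖ * ‖a * w + b‖ = ‖c * w + d‖ := by
    have h1 := congrArg norm heq
    rwa [norm_mul, ← map_mul, ← map_add, ← map_mul, ← map_add, Complex.norm_conj,
      Complex.norm_conj] at h1
  have hle := hφ.norm_le hw1
  have hz := z.norm_lt_one
  have hN : ‖a * w + b‖ = 0 := by
    by_contra hne
    have : 0 < ‖a * w + b‖ := lt_of_le_of_ne (norm_nonneg _) (Ne.symm hne)
    nlinarith
  have hD : c * w + d = 0 := by
    rw [← norm_eq_zero, ← heq', hN, mul_zero]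
  rw [norm_eq_zero] at hN
  have hw0 : w = 0 := by linear_combination d * hN - b * hD - w * hdet
  rw [hw0, mul_zero, zero_add] at hN hD
  simp [hN, hD] at hdet

theorem IsLinearFractional.exists_transpose (hφ : IsLinearFractional φ a b c d)
    (hdet : a * d - b * c = 1) :
    ∃ σ : 𝔻 → 𝔻, IsLinearFractional σ (conj a) (-conj c) (-conj b) (conj d) := by
  refine ⟨fun z => Complex.UnitDisc.mk ((conj a * z + -conj c) / (-conj b * z + conj d)) ?_,
    fun z => ⟨hφ.transpose_denom_ne_zero z, rfl⟩⟩
  rw [norm_div, div_lt_one (norm_pos_iff.2 (hφ.transpose_denom_ne_zero z))]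
  exact hφ.transpose_norm_lt hdet z

theorem IsLinearFractional.memHInf_inv (hφ : IsLinearFractional φ a b c d) :
    MemHInf (fun z => (-conj b * z + conj d)⁻¹) := by
  refine ⟨(isHolomorphic_iff (F := fun z => (-conj b * z + conj d)⁻¹) fun z => rfl).2 ?_,
    (‖d‖ - ‖b‖)⁻¹, fun z => ?_⟩
  · refine DifferentiableOn.inv (by fun_prop) fun z hz => ?_
    exact hφ.transpose_denom_ne_zero (Complex.UnitDisc.mk z (by simpa using hz))
  · rw [norm_inv]
    exact inv_anti₀ (sub_pos.2 hφ.norm_b_lt_norm_d) (norm_sub_norm_le_transpose_denom b d z)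

theorem memHInf_affine (a b : ℂ) : MemHInf (fun z => a * z + b) := by
  refine ⟨(isHolomorphic_iff (F := fun z => a * z + b) fun z => rfl).2 (by fun_prop),
    ‖a‖ + ‖b‖, fun z => (norm_add_le _ _).trans (add_le_add_left ?_ _)⟩
  rw [norm_mul]
  exact mul_le_of_le_one_right (norm_nonneg _) z.norm_lt_one.le

/-- A composition operator with linear fractional symbol maps kernels to weighted kernels. -/
theorem compOp_kernel (hφ : IsLinearFractional φ a b c d) {σ : 𝔻 → 𝔻}
    (hσ : IsLinearFractional σ (conj a) (-conj c) (-conj b) (conj d)) (w : 𝔻) :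
    compOp hφ.isHolomorphic (H2.kernel w) =
      conj (-conj b * (w : ℂ) + conj d)⁻¹ •
        (c • shift (H2.kernel (σ w)) + d • H2.kernel (σ w)) := by
  refine H2.ext fun z => ?_
  simp only [compOp_apply, H2.kernel_apply, H2.smul_apply, H2.add_apply, shift_apply]
  have h1 := H2.one_sub_conj_mul_ne_zero w (φ z)
  have h2 := H2.one_sub_conj_mul_ne_zero (σ w) z
  obtain ⟨h3, h4⟩ := hφ z
  obtain ⟨h5, h6⟩ := hσ w
  rw [eq_div_iff h3] at h4
  rw [eq_div_iff h5] at h6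
  have h7 := congrArg conj h6
  have h8 : -b * conj (w : ℂ) + d ≠ 0 := by
    have := (map_ne_zero (starRingEnd ℂ)).2 h5
    simpa using this
  simp only [map_mul, map_add, map_neg, Complex.conj_conj, map_inv₀] at h7 ⊢
  generalize conj (σ w : ℂ) = s at *
  generalize conj (w : ℂ) = v at *
  obtain ⟨D, hD⟩ : ∃ D, D = -b * v + d := ⟨_, rfl⟩
  obtain ⟨E, hE⟩ : ∃ E, E = 1 - s * z := ⟨_, rfl⟩
  rw [← hE] at h2
  rw [← hD] at h7 h8
  rw [← hD, ← hE]
  field_simp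
  linear_combination -z * h7 + v * h4 + hD + D * hE

/-- The adjoint of a composition operator with linear fractional symbol. -/
theorem adjoint_compOp_shift (hdet : a * d - b * c = 1) (hφ : IsLinearFractional φ a b c d)
    {σ : 𝔻 → 𝔻} (hσ : IsLinearFractional σ (conj a) (-conj c) (-conj b) (conj d)) (f : H2) :
    (compOp hφ.isHolomorphic).adjoint (shift f) =
      shift (mulOp hφ.memHInf_inv (mulOp hφ.memHInf_inv (compOp hσ.isHolomorphic f))) := by
  refine H2.ext fun w => ?_
  rw [← H2.inner_kernel, ContinuousLinearMap.adjoint_inner_right, compOp_kernel hφ hσ,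
    inner_smul_left, inner_add_left, inner_smul_left, inner_smul_left, shift.inner_map_map,
    H2.inner_kernel, H2.inner_kernel, Complex.conj_conj]
  simp only [shift_apply, mulOp_apply, compOp_apply]
  obtain ⟨h5, h6⟩ := hσ w
  -- The determinant gives c̄ + d̄σ(w) = w / D(w), the source of the factor w and of the second D⁻¹.
  have hdet' := congrArg conj hdet
  simp only [map_sub, map_mul, map_one] at hdet'
  rw [h6]
  obtain ⟨D, hD⟩ : ∃ D, D = -conj b * (w : ℂ) + conj d := ⟨_, rfl⟩
  rw [← hD] at h5 ⊢
  field_simp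
  linear_combination w * f (σ w) * hdet' + conj c * f (σ w) * hD

end LinearFractional

/-! ### Division by z and isometric multipliers. -/

theorem IsHolomorphic.divZ {θ : 𝔻 → ℂ} (hθ : IsHolomorphic θ) : IsHolomorphic (divZ θ) :=
  (isHolomorphic_iff (F := dslope (extendZero θ) 0) fun _ => rfl).2
    ((Complex.differentiableOn_dslope (Metric.ball_mem_nhds 0 one_pos)).2 hθ)

theorem coe_mul_divZ {θ : 𝔻 → ℂ} (hθ0 : θ 0 = 0) (z : 𝔻) : z * divZ θ z = θ z := by
  have h0 : extendZero θ 0 = 0 := by simpa [hθ0] using extendZero_coe θ 0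
  have h := sub_smul_dslope (extendZero θ) 0 (z : ℂ)
  rwa [sub_zero, smul_eq_mul, h0, sub_zero, extendZero_coe] at h

theorem memHInf_divZ {θ : 𝔻 → ℂ} (hθ : MemHInf θ) (hθ0 : θ 0 = 0) : MemHInf (divZ θ) := by
  obtain ⟨C, hC⟩ := hθ.2
  have h0 : extendZero θ 0 = 0 := by simpa [hθ0] using extendZero_coe θ 0
  -- Schwarz's lemma wants values in an open ball, whence C + 1; the 1 below is the radius of the
  -- disc.
  refine ⟨hθ.1.divZ, (C + 1) / 1, fun z => ?_⟩
  refine Complex.norm_dslope_le_div_of_mapsTo_ball hθ.1 (fun w hw => ?_)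
    (by simpa using z.norm_lt_one)
  rw [h0, extendZero_of_norm_lt θ (by simpa using hw)]
  simpa using (hC _).trans (lt_add_one C).le

theorem shift_mulOp_divZ {θ : 𝔻 → ℂ} (hθ : MemHInf θ) (hθ0 : θ 0 = 0) (f : H2) :
    shift (mulOp (memHInf_divZ hθ hθ0) f) = mulOp hθ f :=
  H2.ext fun z => by
    rw [shift_apply, mulOp_apply, mulOp_apply, ← mul_assoc, coe_mul_divZ hθ0]

/-- Since the shift and multiplication by θ are isometric, boundary values of θ/z are not needed. -/
theorem norm_mulOp_divZ {θ : 𝔻 → ℂ} (hθ : IsInner θ) (hθ0 : θ 0 = 0) (f : H2) :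
    ‖mulOp (memHInf_divZ hθ.1 hθ0) f‖ = ‖f‖ := by
  rw [← shift.norm_map, shift_mulOp_divZ hθ.1 hθ0, norm_inner_mul hθ]

section IsometricMultiplier

variable {F : 𝔻 → ℂ} {hF : MemHInf F} (hiso : ∀ f, ‖mulOp hF f‖ = ‖f‖)
include hiso

theorem isClosed_mulH2 : IsClosed (mulH2 F : Set H2) := by
  let L : H2 →ₗᵢ[ℂ] H2 := ⟨(mulOp hF).toLinearMap, hiso⟩
  have h : (mulH2 F : Set H2) = Set.range L := by
    ext f
    exact ⟨fun ⟨g, hg⟩ => ⟨g, H2.ext fun z => (mulOp_apply hF g z).trans (hg z).symm⟩,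
      fun ⟨g, hg⟩ => ⟨g, fun z => hg ▸ mulOp_apply hF g z⟩⟩
  rw [h]
  exact L.isometry.isClosedEmbedding.isClosed_range

theorem mulOp_injective {f g : H2} (h : mulOp hF f = mulOp hF g) : f = g := by
  rw [← sub_eq_zero, ← norm_eq_zero, ← hiso, map_sub, h, sub_self, norm_zero]

/-- If `p = q / F` away from the zeros of `F` then `F p = q`. -/
theorem mulOp_eq_of_eq_div {p q : H2} (h : ∀ z, F z ≠ 0 → p z = q z / F z) : mulOp hF p = q := by
  -- Multiplying once more by F makes the identity hold at the zeros of F too; injectivity then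
  -- cancels that factor.
  refine mulOp_injective hiso (H2.ext fun z => ?_)
  simp only [mulOp_apply]
  by_cases hz : F z = 0
  · simp [hz]
  · rw [h z hz, mul_div_cancel₀ _ hz]

theorem norm_le_one_of_isometric_mul (z : 𝔻) : ‖F z‖ ≤ 1 :=
  norm_le_one_of_mul_kernel (fun w => ⟨mulOp hF (H2.kernel w), mulOp_apply hF _, (hiso _).le⟩) z

end IsometricMultiplier

theorem mulOp_mem_mulH2 {F : 𝔻 → ℂ} (hF : MemHInf F) (f : H2) : mulOp hF f ∈ mulH2 F :=
  ⟨f, mulOp_apply hF f⟩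

theorem kernel_zero_apply (z : 𝔻) : H2.kernel 0 z = 1 := by simp [H2.kernel_apply]

/-- Lets ψ k_w be formed in H² while ψ is only known to lie in H². -/
theorem memHInf_kernel (w : 𝔻) : MemHInf (H2.kernel w) := by
  refine ⟨(H2.kernel w).isHolomorphic, (1 - ‖(w : ℂ)‖)⁻¹, fun z => ?_⟩
  rw [H2.kernel_apply, norm_inv]
  refine inv_anti₀ (sub_pos.2 w.norm_lt_one) ?_
  have h := norm_sub_norm_le (1 : ℂ) (conj (w : ℂ) * z)
  rw [norm_one, norm_mul, Complex.norm_conj] at h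
  nlinarith [norm_nonneg (w : ℂ), z.norm_lt_one]

end

end ModelSpace

/-! ### The equivalences. -/

open ModelSpace in
theorem theorem4p5 (θ : Complex.UnitDisc → ℂ) (hθ : ModelSpace.IsInner θ) (hθ0 : θ 0 = 0)
    (a b c d : ℂ) (hdet : a * d - b * c = 1) (φ : Complex.UnitDisc → Complex.UnitDisc)
    (hφ : ModelSpace.IsLinearFractional φ a b c d) :
    ∃ σ : Complex.UnitDisc → Complex.UnitDisc,
      ModelSpace.IsLinearFractional σ (conj a) (-conj c) (-conj b) (conj d) ∧
      List.TFAE [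
        ModelSpace.MemLatComp φ (ModelSpace.modelSpace θ),
        ModelSpace.QuotientSatisfies ModelSpace.MemH2
          (ModelSpace.divZ θ ∘ σ) (ModelSpace.divZ θ),
        ModelSpace.QuotientSatisfies ModelSpace.MemHInf
          (ModelSpace.divZ θ ∘ σ) (ModelSpace.divZ θ),
        ModelSpace.MemLatComp σ (ModelSpace.mulH2 (ModelSpace.divZ θ))] := by
  obtain ⟨σ, hσ⟩ := hφ.exists_transpose hdet
  refine ⟨σ, hσ, ?_⟩
  have hiso := norm_mulOp_divZ hθ hθ0
  set hh := memHInf_divZ hθ.1 hθ0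
  have hhσ : MemHInf (divZ θ ∘ σ) := hh.comp hσ.isHolomorphic
  have hq : ∀ z, mulOp hhσ (H2.kernel 0) z = divZ θ (σ z) := fun z => by
    rw [mulOp_apply, kernel_zero_apply, mul_one, Function.comp_apply]
  -- the quotient satisfies `(θ / z) ψ = (θ / z) ∘ σ` at all points
  have hmul : ∀ p : H2, (∀ z, divZ θ z ≠ 0 → p z = (divZ θ ∘ σ) z / divZ θ z) →
      ∀ z, divZ θ z * p z = divZ θ (σ z) := fun p hp z => by
    rw [← mulOp_apply hh, mulOp_eq_of_eq_div hiso (q := mulOp hhσ (H2.kernel 0)), hq]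
    exact fun z hz => by rw [hp z hz, hq, Function.comp_apply]
  have hmulInf : ∀ ψ, MemHInf ψ → (∀ z, divZ θ z ≠ 0 → ψ z = (divZ θ ∘ σ) z / divZ θ z) →
      ∀ z, divZ θ z * ψ z = divZ θ (σ z) := fun ψ hψ h z => by
    have h1 : ∀ z, mulOp hψ (H2.kernel 0) z = ψ z := fun z => by
      rw [mulOp_apply, kernel_zero_apply, mul_one]
    rw [← h1, hmul _ (fun z hz => by rw [h1, h z hz])]
  tfae_have 1 → 2 := by
    rintro ⟨-, hinv⟩
    -- Invariance dualizes to C_φ*(θ · 1) ∈ Q_θ^⊥, and this complement is θH² by closedness.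
    have hmem : (compOp hφ.isHolomorphic).adjoint (shift (mulOp hh (H2.kernel 0))) ∈
        (mulH2 θ)ᗮᗮ := by
      rw [Submodule.mem_orthogonal]
      intro u hu
      obtain ⟨g, hg, hgu⟩ := hinv u hu
      rw [ContinuousLinearMap.adjoint_inner_right, shift_mulOp_divZ hθ.1 hθ0,
        H2.ext fun z => (compOp_apply hφ.isHolomorphic u z).trans (hgu z).symm]
      exact (Submodule.mem_orthogonal' _ _).1 hg _ (mulOp_mem_mulH2 hθ.1 _)
    rw [Submodule.orthogonal_orthogonal_eq_closure,
      (isClosed_mulH2 (norm_inner_mul hθ)).submodule_topologicalClosure_eq,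
      adjoint_compOp_shift hdet hφ hσ] at hmem
    obtain ⟨u, hu⟩ := hmem
    have hu' := shift.injective ((H2.ext fun z => (hu z).trans (mulOp_apply hθ.1 u z).symm).trans
      (shift_mulOp_divZ hθ.1 hθ0 u).symm)
    have he := memHInf_affine (-conj b) (conj d)
    -- Cancelling z leaves h u = D⁻² (h∘σ), so ψ = D² u.
    refine ⟨mulOp he (mulOp he u), (mulOp he (mulOp he u)).2, fun z hz => ?_⟩
    have hz' := congrArg (fun f : H2 => f z) hu'
    simp only [mulOp_apply, compOp_apply, kernel_zero_apply, mul_one] at hz' ⊢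
    have hd := hφ.transpose_denom_ne_zero z
    rw [Function.comp_apply, eq_div_iff hz]
    generalize -conj b * (z : ℂ) + conj d = D at hd hz' ⊢
    field_simp at hz'
    linear_combination -hz'
  tfae_have 2 → 3 := by
    rintro ⟨ψ, hψ, hquot⟩
    let p : H2 := ⟨ψ, hψ⟩
    have hp : ∀ z, divZ θ z * p z = divZ θ (σ z) := hmul p hquot
    refine ⟨ψ, ⟨p.isHolomorphic, 1, norm_le_one_of_mul_kernel fun w =>
      ⟨mulOp (memHInf_kernel w) p, fun z => ?_, ?_⟩⟩, hquot⟩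
    · rw [mulOp_apply, mul_comm]
    · have h1 : mulOp hh (mulOp (memHInf_kernel w) p) = mulOp hhσ (H2.kernel w) :=
        H2.ext fun z => by
          simp only [mulOp_apply, Function.comp_apply, ← hp z]
          ring
      rw [← hiso, h1]
      simpa using norm_mulOp_le hhσ (fun z => norm_le_one_of_isometric_mul hiso (σ z)) (H2.kernel w)
  tfae_have 3 → 1 := by
    rintro ⟨ψ, hψ, hquot⟩
    have hp := hmulInf ψ hψ hquot
    refine ⟨Submodule.isClosed_orthogonal _, fun f hf =>
      ⟨compOp hφ.isHolomorphic f, ?_, compOp_apply _ f⟩⟩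
    rw [modelSpace, Submodule.mem_orthogonal']
    rintro v ⟨u, hu⟩
    rw [H2.ext fun z => (hu z).trans (mulOp_apply hθ.1 u z).symm, ← shift_mulOp_divZ hθ.1 hθ0,
      ← ContinuousLinearMap.adjoint_inner_right, adjoint_compOp_shift hdet hφ hσ]
    -- The witness comes from C_φ*(θu) = z D⁻² (h∘σ)(u∘σ) = θ · D⁻² ψ (u∘σ).
    refine (Submodule.mem_orthogonal' _ _).1 hf _ ⟨mulOp hφ.memHInf_inv (mulOp hφ.memHInf_inv
      (mulOp hψ (compOp hσ.isHolomorphic u))), fun z => ?_⟩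
    simp only [shift_apply, mulOp_apply, compOp_apply, ← hp z, ← coe_mul_divZ hθ0 z]
    ring
  tfae_have 3 → 4 := by
    rintro ⟨ψ, hψ, hquot⟩
    have hp := hmulInf ψ hψ hquot
    refine ⟨isClosed_mulH2 hiso, fun f ⟨u, hu⟩ =>
      ⟨mulOp hh (mulOp hψ (compOp hσ.isHolomorphic u)), mulOp_mem_mulH2 hh _, fun z => ?_⟩⟩
    simp only [mulOp_apply, compOp_apply, hu, ← hp z]
    ring
  tfae_have 4 → 2 := by
    rintro ⟨-, hinv⟩
    -- Applied to h · 1, invariance gives h∘σ = h v, so v is ψ.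
    obtain ⟨g, ⟨v, hv⟩, hg⟩ := hinv _ (mulOp_mem_mulH2 hh (H2.kernel 0))
    refine ⟨v, v.2, fun z hz => ?_⟩
    rw [eq_div_iff hz, mul_comm, ← hv, hg, mulOp_apply, kernel_zero_apply, mul_one,
      Function.comp_apply]
  tfae_finish
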